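/- Let $G=(V(G),E(G))$ be a finite simple graph. Let $(w_f)_{f\in E(G)}$ be i.i.d. real edge weights and $(\nu_x)_{x\in V(G)}$ i.i.d. real vertex weights, all of them independent (the edge and vertex laws may differ; no moment condition is imposed). For a subgraph $H\subseteq G$, a matching of $H$ is a set $M\subseteq E(H)$ of edges no two of which share a vertex, and the disordered monomer-dimer model on $H$ is the random Gibbs measure $$\mu_H(M)=Z_H^{-1}\exp\Big(\sum_{f\in M}w_f+\sum_{x\in V(H),\ x\notin M}\nu_x\Big),\qquad Z_H=\sum_{M}\exp\Big(\sum_{f\in M}w_f+\sum_{x\in V(H),\ x\notin M}\nu_x\Big),$$ where $M$ runs over all matchings of $H$ (also in the sum $\sum_M$) and $x\notin M$ means that no edge of $M$ contains $x$. Given the weights, let $\mathcal M_H$ be a random matching with law $\mu_H$ and let $\langle\cdot\rangle$ be the expectation over it. For an edge $e=(xy)$ and $R\ge 1$ let $\mathbb B^e_R$ be the subgraph of $G$ induced by all vertices at graph distance at most $R$ from $x$ or from $y$. **Theorem.** For every integer $D\ge 0$ and all probability distributions $\mathcal L_w,\mathcal L_\nu$ on $\mathbb R$ there exist constants $c,C>0$,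 depending only on $D$, $\mathcal L_w$ and $\mathcal L_\nu$, such that for every finite graph $G$ with maximum degree at most $D$, with edge weights of law $\mathcal L_w$ and vertex weights of law $\mathcal L_\nu$ as above, every edge $e\in E(G)$ and every real $R\ge 1$, $$\mathbf E\Big|\big\langle \mathbf 1_{\{e\in\mathcal M_G\}}\big\rangle-\big\langle \mathbf 1_{\{e\in\mathcal M_{\mathbb B^e_R}\}}\big\rangle\Big|\le C e^{-cR}.$$ -/

import Mathlib

open MeasureTheory ProbabilityTheory

universe u v

namespace MonomerDimer

variable {V : Type*} {G : SimpleGraph V}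

/-- `M` is a (partial) matching of the subgraph `H` of `G`: a set of edges of `H`, no two of which
share a vertex. -/
def IsMatching (H : G.Subgraph) (M : Finset G.edgeSet) : Prop :=
  (∀ f ∈ M, (f : Sym2 V) ∈ H.edgeSet) ∧
    ∀ f ∈ M, ∀ g ∈ M, f ≠ g → ∀ x : V, ¬(x ∈ (f : Sym2 V) ∧ x ∈ (g : Sym2 V))

/-- The vertex `x` is left unmatched by the set of edges `M`. -/
def Unmatched (M : Finset G.edgeSet) (x : V) : Prop :=
  ∀ f ∈ M, x ∉ (f : Sym2 V)

/-- The subgraph of `G` induced by all vertices at distance at most `R` from an endpoint of `e`.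
Reachability is required explicitly since `G.dist` is `0` between different components. -/
def edgeBall (G : SimpleGraph V) (e : Sym2 V) (R : ℝ) : G.Subgraph :=
  (⊤ : G.Subgraph).induce {v | ∃ x ∈ e, G.Reachable x v ∧ (G.dist x v : ℝ) ≤ R}

variable [Fintype V]

open Classical in
/-- The finite set of all matchings of `H`. -/
noncomputable def matchings (H : G.Subgraph) : Finset (Finset G.edgeSet) :=
  Finset.univ.filter (IsMatching H)

open Classical in
/-- The unnormalised Gibbs weight of `M` on `H` (inverse temperature absorbed in the weights): `exp`
of the sum of `w` over the edges in `M` and of `ν` over the vertices of `H` unmatched by `M`. -/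
noncomputable def boltzmann (H : G.Subgraph) (w : G.edgeSet → ℝ) (ν : V → ℝ)
    (M : Finset G.edgeSet) : ℝ :=
  Real.exp (∑ f ∈ M, w f + ∑ x : V with x ∈ H.verts ∧ Unmatched M x, ν x)

/-- The partition function of the monomer-dimer model on `H`. -/
noncomputable def partitionFunction (H : G.Subgraph) (w : G.edgeSet → ℝ) (ν : V → ℝ) : ℝ :=
  ∑ M ∈ matchings H, boltzmann H w ν M

/-- The Gibbs probability of the matching `M` of `H`. -/
noncomputable def gibbs (H : G.Subgraph) (w : G.edgeSet → ℝ) (ν : V → ℝ)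
    (M : Finset G.edgeSet) : ℝ :=
  (partitionFunction H w ν)⁻¹ * boltzmann H w ν M

/-- The Gibbs expectation of `φ` of a random matching of `H`. -/
noncomputable def gibbsExpectation (H : G.Subgraph) (w : G.edgeSet → ℝ) (ν : V → ℝ)
    (φ : Finset G.edgeSet → ℝ) : ℝ :=
  ∑ M ∈ matchings H, φ M * gibbs H w ν M

open Classical in
/-- The edge marginal: Gibbs expectation of the indicator that `e` lies in the random matching
of `H`. -/
noncomputable def edgeMarginal (H : G.Subgraph) (w : G.edgeSet → ℝ) (ν : V → ℝ)
    (e : G.edgeSet) : ℝ :=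
  gibbsExpectation H w ν (fun M => if e ∈ M then 1 else 0)

end MonomerDimer

namespace MonomerDimer

/-! ### Vertex-deletion recursion for monomer probabilities -/

section Combinatorics

variable {V : Type*} {G : SimpleGraph V}

/-! Write `p_A(x)` for the probability that `x` is unmatched in the model on the vertex set `A`, and
`a_xy = exp (w_xy - ν_x - ν_y)`. Deleting vertices one at a time gives `p_A(x) = (1 + ∑ a_xy p_{A \
x}(y))⁻¹` (`monomerProb_eq`), and the marginal of `xy` is `a_xy p_A(x) p_{A \ x}(y)`
(`edgeMarginal_induce`).

In the coordinate `log p` this recursion never expands sup-distances, and it contracts by `K / (1 +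
K)` at a vertex whose total activity is at most `K`; call such a vertex good. At a good vertex two
values of `log p` differ by at most `log (1 + K)`, whatever the model looks like further away. Since
visited vertices are deleted, unfolding the recursion follows self-avoiding walks. Hence two vertex
sets that agree up to distance `n` have monomer probabilities exponentially close in `n`, provided
every self-avoiding walk of length `n` meets a positive fraction of good vertices
(`abs_log_monomerProb_sub_le_pow`).

This holds outside an event of exponentially small probability. A walk with too few good vertices
has many weights of size above `T` near it, because each weight influences at most `D + 2` vertices.
For `T` large, independence and a union bound over walks and over sets of large weights make this
unlikely (`measure_hasBadPath_le`). On the exceptional event the difference of marginals is at most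
`1`. Only tightness of the two laws is used, hence no moment condition. -/

lemma isMatching_induce_iff {A : Set V} {M : Finset G.edgeSet} :
    IsMatching ((⊤ : G.Subgraph).induce A) M ↔
      (∀ f ∈ M, ∀ x ∈ (f : Sym2 V), x ∈ A) ∧
        ∀ f ∈ M, ∀ g ∈ M, f ≠ g → ∀ x : V, ¬(x ∈ (f : Sym2 V) ∧ x ∈ (g : Sym2 V)) := by
  unfold IsMatching
  refine and_congr_left fun _ => forall₂_congr fun f _ => ?_
  obtain ⟨f, hf⟩ := f
  induction f with
  | _ a b =>
    rw [SimpleGraph.mem_edgeSet] at hf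
    simp [hf]

lemma isMatching_diff_singleton_iff {A : Set V} {M : Finset G.edgeSet} {x : V} :
    IsMatching ((⊤ : G.Subgraph).induce (A \ {x})) M ↔
      IsMatching ((⊤ : G.Subgraph).induce A) M ∧ Unmatched M x := by
  simp only [isMatching_induce_iff, Unmatched, Set.mem_sdiff, Set.mem_singleton_iff]
  constructor
  · rintro ⟨h, h'⟩
    exact ⟨⟨fun f hf v hv => (h f hf v hv).1, h'⟩, fun f hf hx => (h f hf x hx).2 rfl⟩
  · rintro ⟨⟨h, h'⟩, hx⟩
    exact ⟨fun f hf v hv => ⟨h f hf v hv, fun hvx => hx f hf (hvx ▸ hv)⟩, h'⟩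

/-- The activity of the edge between `x` and `y`. -/
noncomputable def activity (w : G.edgeSet → ℝ) (ν : V → ℝ) {x y : V} (h : G.Adj x y) : ℝ :=
  Real.exp (w ⟨s(x, y), h⟩ - ν x - ν y)

lemma activity_pos (w : G.edgeSet → ℝ) (ν : V → ℝ) {x y : V} (h : G.Adj x y) :
    0 < activity w ν h := Real.exp_pos _

variable [Fintype V]

/-- The partition function of the subgraph of `G` induced by `A`. -/
noncomputable def inducedZ (w : G.edgeSet → ℝ) (ν : V → ℝ) (A : Set V) : ℝ :=
  partitionFunction ((⊤ : G.Subgraph).induce A) w ν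

lemma inducedZ_pos (w : G.edgeSet → ℝ) (ν : V → ℝ) (A : Set V) : 0 < inducedZ w ν A := by
  classical
  refine Finset.sum_pos (fun _ _ => Real.exp_pos _) ⟨∅, ?_⟩
  simp [matchings, IsMatching]

open Classical in
lemma sum_boltzmann_unmatched (w : G.edgeSet → ℝ) (ν : V → ℝ) {A : Set V} {x : V} (hx : x ∈ A) :
    ∑ M ∈ matchings ((⊤ : G.Subgraph).induce A) with Unmatched M x,
        boltzmann ((⊤ : G.Subgraph).induce A) w ν M =
      Real.exp (ν x) * inducedZ w ν (A \ {x}) := by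
  have hset : (matchings ((⊤ : G.Subgraph).induce A)).filter (fun M => Unmatched M x) =
      matchings ((⊤ : G.Subgraph).induce (A \ {x})) := by
    ext M
    simp [matchings, isMatching_diff_singleton_iff]
  rw [inducedZ, partitionFunction, Finset.mul_sum, hset]
  refine Finset.sum_congr rfl fun M hM => ?_
  have hM' : Unmatched M x := by
    simp only [matchings, Finset.mem_filter, isMatching_diff_singleton_iff] at hM
    exact hM.2.2
  rw [boltzmann, boltzmann, ← Real.exp_add]
  congr 1
  have : (Finset.univ.filter fun v => v ∈ ((⊤ : G.Subgraph).induce A).verts ∧ Unmatched M v) =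
      insert x (Finset.univ.filter fun v =>
        v ∈ ((⊤ : G.Subgraph).induce (A \ {x})).verts ∧ Unmatched M v) := by
    ext v
    by_cases hv : v = x
    · subst hv; simp [hx, hM']
    · simp [hv]
  rw [this, Finset.sum_insert (by simp)]
  ring

-- Inserting the edge is a bijection from the matchings avoiding both endpoints onto the matchings
-- that contain it; erasing it is the inverse.
open Classical in
lemma sum_boltzmann_mem (w : G.edgeSet → ℝ) (ν : V → ℝ) {A : Set V} {x y : V} (hx : x ∈ A)
    (hy : y ∈ A) (h : G.Adj x y) :
    ∑ M ∈ matchings ((⊤ : G.Subgraph).induce A) with (⟨s(x, y), h⟩ : G.edgeSet) ∈ M,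
        boltzmann ((⊤ : G.Subgraph).induce A) w ν M =
      Real.exp (w ⟨s(x, y), h⟩) * inducedZ w ν ((A \ {x}) \ {y}) := by
  set e : G.edgeSet := ⟨s(x, y), h⟩ with he
  have hmem : ∀ v, v ∈ (e : Sym2 V) ↔ v = x ∨ v = y := fun v => Sym2.mem_iff
  rw [inducedZ, partitionFunction, Finset.mul_sum]
  have hnot : ∀ M ∈ matchings ((⊤ : G.Subgraph).induce ((A \ {x}) \ {y})), e ∉ M := by
    intro M hM heM
    simp only [matchings, Finset.mem_filter, isMatching_diff_singleton_iff] at hM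
    exact hM.2.2 e heM ((hmem y).2 (Or.inr rfl))
  symm
  refine Finset.sum_bij' (fun M _ => insert e M) (fun M _ => M.erase e) ?_ ?_ ?_ ?_ ?_
  · intro M hM
    simp only [matchings, Finset.mem_filter, Finset.mem_univ, true_and, isMatching_diff_singleton_iff]
      at hM ⊢
    rw [isMatching_induce_iff] at hM ⊢
    obtain ⟨⟨⟨h1, h2⟩, h3⟩, h4⟩ := hM
    have key : ∀ f ∈ M, ∀ v, v ∈ (e : Sym2 V) → v ∉ (f : Sym2 V) := by
      intro f hf v hv
      rcases (hmem v).1 hv with rfl | rfl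
      · exact h3 f hf
      · exact h4 f hf
    refine ⟨⟨?_, ?_⟩, Finset.mem_insert_self _ _⟩
    · intro f hf v hv
      rcases Finset.mem_insert.1 hf with rfl | hf
      · rcases (hmem v).1 hv with rfl | rfl <;> assumption
      · exact h1 f hf v hv
    · intro f hf g hg hfg v hv
      rcases Finset.mem_insert.1 hf with hf | hf <;> rcases Finset.mem_insert.1 hg with hg | hg
      · exact hfg (hf.trans hg.symm)
      · exact key g hg v (hf ▸ hv.1) hv.2
      · exact key f hf v (hg ▸ hv.2) hv.1
      · exact h2 f hf g hg hfg v hv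
  · intro M hM
    simp only [matchings, Finset.mem_filter, Finset.mem_univ, true_and, isMatching_diff_singleton_iff]
      at hM ⊢
    rw [isMatching_induce_iff] at hM ⊢
    obtain ⟨⟨h1, h2⟩, h3⟩ := hM
    refine ⟨⟨⟨fun f hf => h1 f (Finset.mem_of_mem_erase hf), fun f hf g hg =>
      h2 f (Finset.mem_of_mem_erase hf) g (Finset.mem_of_mem_erase hg)⟩, ?_⟩, ?_⟩
    · intro f hf hxf
      exact h2 f (Finset.mem_of_mem_erase hf) e h3 (Finset.ne_of_mem_erase hf) x
        ⟨hxf, (hmem x).2 (Or.inl rfl)⟩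
    · intro f hf hxf
      exact h2 f (Finset.mem_of_mem_erase hf) e h3 (Finset.ne_of_mem_erase hf) y
        ⟨hxf, (hmem y).2 (Or.inr rfl)⟩
  · intro M hM
    exact Finset.erase_insert (hnot M hM)
  · intro M hM
    exact Finset.insert_erase (Finset.mem_filter.1 hM).2
  · intro M hM
    rw [boltzmann, boltzmann, ← Real.exp_add, Finset.sum_insert (hnot M hM), add_assoc]
    congr 3
    refine Finset.sum_congr ?_ fun _ _ => rfl
    ext v
    simp only [Finset.mem_filter, Finset.mem_univ, true_and, SimpleGraph.Subgraph.induce_verts,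
      Set.mem_sdiff, Set.mem_singleton_iff, Unmatched, Finset.forall_mem_insert, hmem]
    tauto

open Classical in
variable (G) in
/-- The neighbours of `x` lying in `A`. -/
noncomputable def neighborsIn (A : Set V) (x : V) : Finset (G.neighborSet x) :=
  Finset.univ.filter fun y => (y : V) ∈ A

lemma mem_neighborsIn {A : Set V} {x : V} {y : G.neighborSet x} :
    y ∈ neighborsIn G A x ↔ (y : V) ∈ A := by
  simp [neighborsIn]

open Classical in
/-- A vertex of `A` is either unmatched or matched along exactly one edge. -/
lemma inducedZ_eq_add_sum (w : G.edgeSet → ℝ) (ν : V → ℝ) {A : Set V} {x : V} (hx : x ∈ A) :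
    inducedZ w ν A = Real.exp (ν x) * inducedZ w ν (A \ {x}) +
      ∑ y ∈ neighborsIn G A x,
        Real.exp (w ⟨s(x, y), y.2⟩) * inducedZ w ν ((A \ {x}) \ {(y : V)}) := by
  rw [← sum_boltzmann_unmatched w ν hx]
  have h1 : ∀ y ∈ neighborsIn G A x,
      Real.exp (w ⟨s(x, y), y.2⟩) * inducedZ w ν ((A \ {x}) \ {(y : V)}) =
      ∑ M ∈ matchings ((⊤ : G.Subgraph).induce A) with (⟨s(x, y), y.2⟩ : G.edgeSet) ∈ M,
        boltzmann ((⊤ : G.Subgraph).induce A) w ν M := fun y hy =>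
    (sum_boltzmann_mem w ν hx (mem_neighborsIn.1 hy) y.2).symm
  rw [Finset.sum_congr rfl h1]
  simp only [Finset.sum_filter (s := matchings _)]
  rw [Finset.sum_comm, ← Finset.sum_add_distrib, inducedZ, partitionFunction]
  refine Finset.sum_congr rfl fun M hM => ?_
  simp only [matchings, Finset.mem_filter, Finset.mem_univ, true_and, isMatching_induce_iff] at hM
  obtain ⟨hA, hdis⟩ := hM
  by_cases hU : Unmatched M x
  · rw [if_pos hU, Finset.sum_eq_zero, add_zero]
    intro y _
    exact if_neg fun hy => hU _ hy (Sym2.mem_mk_left _ _)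
  · rw [if_neg hU, zero_add]
    unfold Unmatched at hU
    push Not at hU
    obtain ⟨f, hf, hxf⟩ := hU
    obtain ⟨y, hy⟩ := Sym2.mem_iff_exists.1 hxf
    have hadj : G.Adj x y := by
      have := f.2
      rwa [hy] at this
    have hfe : f = ⟨s(x, y), hadj⟩ := Subtype.ext hy
    have hyA : y ∈ A := hA f hf y (by rw [hy]; exact Sym2.mem_mk_right _ _)
    rw [Finset.sum_eq_single_of_mem (⟨y, hadj⟩ : G.neighborSet x) (mem_neighborsIn.2 hyA)]
    · rw [if_pos (hfe ▸ hf)]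
    · intro z _ hz
      refine if_neg fun hzM => ?_
      refine hdis _ hzM f hf ?_ x ⟨Sym2.mem_mk_left _ _, hxf⟩
      rw [hfe]
      intro heq
      have := congrArg Subtype.val heq
      simp only [Sym2.congr_right] at this
      exact hz (Subtype.ext this)

/-- The probability that `x` is unmatched in the model on `A`. -/
noncomputable def monomerProb (w : G.edgeSet → ℝ) (ν : V → ℝ) (A : Set V) (x : V) : ℝ :=
  Real.exp (ν x) * inducedZ w ν (A \ {x}) / inducedZ w ν A

lemma monomerProb_pos (w : G.edgeSet → ℝ) (ν : V → ℝ) (A : Set V) (x : V) :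
    0 < monomerProb w ν A x :=
  div_pos (mul_pos (Real.exp_pos _) (inducedZ_pos ..)) (inducedZ_pos ..)

/-- Divide the decomposition `inducedZ_eq_add_sum` by its unmatched term. The vertex weights are
absorbed in the activities, and `x` is absent from the sets on the right. -/
lemma monomerProb_eq (w : G.edgeSet → ℝ) (ν : V → ℝ) {A : Set V} {x : V} (hx : x ∈ A) :
    monomerProb w ν A x = (1 + ∑ y ∈ neighborsIn G A x,
      activity w ν y.2 * monomerProb w ν (A \ {x}) y)⁻¹ := by
  have h1 := inducedZ_pos w ν (A \ {x})
  have hZ : inducedZ w ν A = (Real.exp (ν x) * inducedZ w ν (A \ {x})) *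
      (1 + ∑ y ∈ neighborsIn G A x,
        activity w ν y.2 * monomerProb w ν (A \ {x}) y) := by
    rw [inducedZ_eq_add_sum w ν hx, mul_add, mul_one, Finset.mul_sum]
    congr 1
    refine Finset.sum_congr rfl fun y _ => ?_
    unfold activity monomerProb
    rw [Real.exp_sub, Real.exp_sub]
    field_simp
  have h2 := inducedZ_pos w ν A
  rw [hZ] at h2
  rw [monomerProb, hZ, div_mul_eq_div_div, div_self (by positivity), one_div]

lemma monomerProb_le_one (w : G.edgeSet → ℝ) (ν : V → ℝ) {A : Set V} {x : V} (hx : x ∈ A) :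
    monomerProb w ν A x ≤ 1 := by
  rw [monomerProb_eq w ν hx]
  refine inv_le_one_of_one_le₀ (le_add_of_nonneg_right (Finset.sum_nonneg fun y _ => ?_))
  exact mul_nonneg (activity_pos ..).le (monomerProb_pos ..).le

lemma edgeMarginal_nonneg (H : G.Subgraph) (w : G.edgeSet → ℝ) (ν : V → ℝ) (e : G.edgeSet) :
    0 ≤ edgeMarginal H w ν e := by
  unfold edgeMarginal gibbsExpectation gibbs partitionFunction boltzmann
  refine Finset.sum_nonneg fun M _ => mul_nonneg (by dsimp only; split_ifs <;> norm_num) ?_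
  positivity

lemma edgeMarginal_le_one (H : G.Subgraph) (w : G.edgeSet → ℝ) (ν : V → ℝ) (e : G.edgeSet) :
    edgeMarginal H w ν e ≤ 1 := by
  have hnn : ∀ M, 0 ≤ gibbs H w ν M := fun M => by
    unfold gibbs partitionFunction boltzmann
    positivity
  calc edgeMarginal H w ν e ≤ ∑ M ∈ matchings H, gibbs H w ν M := by
        refine Finset.sum_le_sum fun M _ => ?_
        refine mul_le_of_le_one_left (hnn M) ?_
        dsimp only
        split_ifs <;> norm_num
    _ ≤ 1 := by
        unfold gibbs
        rw [← Finset.mul_sum]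
        exact inv_mul_le_one

/-- The ratio of partition functions with and without both endpoints telescopes through `A \ {x}`.
-/
lemma edgeMarginal_induce (w : G.edgeSet → ℝ) (ν : V → ℝ) {A : Set V} {x y : V} (hx : x ∈ A)
    (hy : y ∈ A) (h : G.Adj x y) :
    edgeMarginal ((⊤ : G.Subgraph).induce A) w ν ⟨s(x, y), h⟩ =
      activity w ν h * (monomerProb w ν A x * monomerProb w ν (A \ {x}) y) := by
  classical
  have h1 := inducedZ_pos w ν (A \ {x})
  have h2 := inducedZ_pos w ν A
  have : edgeMarginal ((⊤ : G.Subgraph).induce A) w ν ⟨s(x, y), h⟩ =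
      (inducedZ w ν A)⁻¹ * (Real.exp (w ⟨s(x, y), h⟩) * inducedZ w ν ((A \ {x}) \ {y})) := by
    rw [← sum_boltzmann_mem w ν hx hy h, Finset.mul_sum, Finset.sum_filter, edgeMarginal,
      gibbsExpectation]
    refine Finset.sum_congr rfl fun M _ => ?_
    simp only [gibbs, inducedZ]
    split_ifs <;> simp
  rw [this, monomerProb, monomerProb, activity, Real.exp_sub, Real.exp_sub]
  field_simp

end Combinatorics

/-! ### Contraction of the recursion in logarithmic coordinates -/

section Contraction

/-- One-sided Lipschitz bound for `p ↦ log (1 + ∑ a p)` in logarithmic coordinates. -/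
lemma one_add_sum_le_exp_mul {ι : Type*} (s : Finset ι) {a p q : ι → ℝ} {t K : ℝ}
    (ha : ∀ i ∈ s, 0 ≤ a i) (hq0 : ∀ i ∈ s, 0 < q i) (hq1 : ∀ i ∈ s, q i ≤ 1)
    (hp : ∀ i ∈ s, 0 < p i) (ht : 0 ≤ t) (hpq : ∀ i ∈ s, |Real.log (p i) - Real.log (q i)| ≤ t)
    (hK : ∑ i ∈ s, a i ≤ K) :
    1 + ∑ i ∈ s, a i * q i ≤ Real.exp (K / (1 + K) * t) * (1 + ∑ i ∈ s, a i * p i) := by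
  set Q := ∑ i ∈ s, a i * q i with hQ
  have hQ0 : 0 ≤ Q := Finset.sum_nonneg fun i hi => mul_nonneg (ha i hi) (hq0 i hi).le
  have hQK : Q ≤ K := le_trans
    (Finset.sum_le_sum fun i hi => mul_le_of_le_one_right (ha i hi) (hq1 i hi)) hK
  have hP : Real.exp (-t) * Q ≤ ∑ i ∈ s, a i * p i := by
    rw [hQ, Finset.mul_sum]
    refine Finset.sum_le_sum fun i hi => ?_
    rw [mul_left_comm]
    refine mul_le_mul_of_nonneg_left ?_ (ha i hi)
    rw [← Real.exp_log (hq0 i hi), ← Real.exp_add, ← Real.exp_log (hp i hi), Real.exp_le_exp]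
    have := (abs_le.1 (hpq i hi)).1
    linarith
  -- Convexity of `exp` between `0` and `-t`, with weights `1 / (1 + Q)` and `Q / (1 + Q)`, bounds
  -- `(1 + exp (-t) * Q) / (1 + Q)` below by `exp (-t * Q / (1 + Q))`.
  have hconv := convexOn_exp.2 (Set.mem_univ 0) (Set.mem_univ (-t))
    (show 0 ≤ 1 / (1 + Q) by positivity) (show 0 ≤ Q / (1 + Q) by positivity)
    (by field_simp)
  simp only [smul_eq_mul, mul_zero, zero_add, Real.exp_zero, mul_one] at hconv
  have hθ : Q / (1 + Q) ≤ K / (1 + K) := by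
    rw [div_le_div_iff₀ (by linarith) (by linarith)]
    nlinarith
  have h1 : Real.exp (-(K / (1 + K) * t)) ≤ Real.exp (Q / (1 + Q) * -t) := by
    rw [Real.exp_le_exp]
    nlinarith
  have h2 : Real.exp (-(K / (1 + K) * t)) * (1 + Q) ≤ 1 + ∑ i ∈ s, a i * p i := by
    calc _ ≤ (1 / (1 + Q) + Q / (1 + Q) * Real.exp (-t)) * (1 + Q) := by
          gcongr
          exact h1.trans hconv
      _ = 1 + Real.exp (-t) * Q := by field_simp
      _ ≤ _ := by linarith
  calc 1 + Q = Real.exp (K / (1 + K) * t) * (Real.exp (-(K / (1 + K) * t)) * (1 + Q)) := by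
        rw [← mul_assoc, ← Real.exp_add, add_neg_cancel, Real.exp_zero, one_mul]
    _ ≤ _ := by gcongr

lemma abs_log_one_add_sum_sub_le {ι : Type*} (s : Finset ι) {a p q : ι → ℝ} {t K : ℝ}
    (ha : ∀ i ∈ s, 0 ≤ a i) (hp0 : ∀ i ∈ s, 0 < p i) (hp1 : ∀ i ∈ s, p i ≤ 1)
    (hq0 : ∀ i ∈ s, 0 < q i) (hq1 : ∀ i ∈ s, q i ≤ 1) (ht : 0 ≤ t)
    (hpq : ∀ i ∈ s, |Real.log (p i) - Real.log (q i)| ≤ t) (hK : ∑ i ∈ s, a i ≤ K) :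
    |Real.log (1 + ∑ i ∈ s, a i * p i) - Real.log (1 + ∑ i ∈ s, a i * q i)| ≤
      K / (1 + K) * t := by
  have hP0 : 0 ≤ ∑ i ∈ s, a i * p i :=
    Finset.sum_nonneg fun i hi => mul_nonneg (ha i hi) (hp0 i hi).le
  have hQ0 : 0 ≤ ∑ i ∈ s, a i * q i :=
    Finset.sum_nonneg fun i hi => mul_nonneg (ha i hi) (hq0 i hi).le
  have h1 := Real.log_le_log (by positivity)
    (one_add_sum_le_exp_mul s ha hq0 hq1 hp0 ht hpq hK)
  have h2 := Real.log_le_log (by positivity)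
    (one_add_sum_le_exp_mul s ha hp0 hp1 hq0 ht
      (fun i hi => by rw [abs_sub_comm]; exact hpq i hi) hK)
  rw [Real.log_mul (Real.exp_pos _).ne' (by positivity), Real.log_exp] at h1 h2
  rw [abs_le]
  constructor <;> linarith

variable {V : Type*} {G : SimpleGraph V} [Fintype V]

/-- The total activity at `x` towards `A` is at most `K`. -/
def ActivityBounded (w : G.edgeSet → ℝ) (ν : V → ℝ) (K : ℝ) (x : V) : Prop :=
  ∀ A : Set V, ∑ y ∈ neighborsIn G A x, activity w ν y.2 ≤ K

lemma abs_log_monomerProb_sub_eq (w : G.edgeSet → ℝ) (ν : V → ℝ) {A B : Set V} {x : V}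
    (hA : x ∈ A) (hB : x ∈ B) (h : neighborsIn G A x = neighborsIn G B x) :
    |Real.log (monomerProb w ν A x) - Real.log (monomerProb w ν B x)| =
      |Real.log (1 + ∑ y ∈ neighborsIn G A x, activity w ν y.2 * monomerProb w ν (A \ {x}) y) -
        Real.log (1 + ∑ y ∈ neighborsIn G A x, activity w ν y.2 * monomerProb w ν (B \ {x}) y)| := by
  rw [monomerProb_eq w ν hA, monomerProb_eq w ν hB, Real.log_inv, Real.log_inv, ← h, neg_sub_neg,
    abs_sub_comm]

lemma mem_sdiff_singleton_of_mem_neighborsIn {A : Set V} {x : V} {y : G.neighborSet x}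
    (hy : y ∈ neighborsIn G A x) : (y : V) ∈ A \ {x} :=
  ⟨mem_neighborsIn.1 hy, fun h => G.ne_of_adj y.2 (Set.mem_singleton_iff.1 h).symm⟩

lemma abs_log_monomerProb_sub_le (w : G.edgeSet → ℝ) (ν : V → ℝ) {A B : Set V} {x : V} {t K : ℝ}
    (hA : x ∈ A) (hB : x ∈ B) (h : neighborsIn G A x = neighborsIn G B x) (ht : 0 ≤ t)
    (hpq : ∀ y ∈ neighborsIn G A x,
      |Real.log (monomerProb w ν (A \ {x}) y) - Real.log (monomerProb w ν (B \ {x}) y)| ≤ t)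
    (hK : ActivityBounded w ν K x) :
    |Real.log (monomerProb w ν A x) - Real.log (monomerProb w ν B x)| ≤ K / (1 + K) * t := by
  rw [abs_log_monomerProb_sub_eq w ν hA hB h]
  exact abs_log_one_add_sum_sub_le _ (fun _ _ => (activity_pos ..).le)
    (fun _ _ => monomerProb_pos ..)
    (fun y hy => monomerProb_le_one _ _ (mem_sdiff_singleton_of_mem_neighborsIn hy))
    (fun _ _ => monomerProb_pos ..)
    (fun y hy => monomerProb_le_one _ _ (mem_sdiff_singleton_of_mem_neighborsIn (h ▸ hy)))
    ht hpq (hK A)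

/-- The total activity at `x` is finite even when it is not controlled, so the contraction factor is
still below `1`: bad vertices do no harm. -/
lemma abs_log_monomerProb_sub_le' (w : G.edgeSet → ℝ) (ν : V → ℝ) {A B : Set V} {x : V} {t : ℝ}
    (hA : x ∈ A) (hB : x ∈ B) (h : neighborsIn G A x = neighborsIn G B x) (ht : 0 ≤ t)
    (hpq : ∀ y ∈ neighborsIn G A x,
      |Real.log (monomerProb w ν (A \ {x}) y) - Real.log (monomerProb w ν (B \ {x}) y)| ≤ t) :
    |Real.log (monomerProb w ν A x) - Real.log (monomerProb w ν B x)| ≤ t := by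
  classical
  have hnn : 0 ≤ ∑ y : G.neighborSet x, activity w ν y.2 :=
    Finset.sum_nonneg fun _ _ => (activity_pos ..).le
  refine (abs_log_monomerProb_sub_le w ν (K := ∑ y : G.neighborSet x, activity w ν y.2)
    hA hB h ht hpq fun A => ?_).trans ?_
  · exact Finset.sum_le_univ_sum_of_nonneg fun _ => (activity_pos ..).le
  · refine mul_le_of_le_one_left ht ((div_le_one (by linarith)).2 (by linarith))

/-- This bound is uniform in `A`; it starts the iteration with no information about the model beyond
`x`. -/
lemma log_monomerProb_bounds (w : G.edgeSet → ℝ) (ν : V → ℝ) {A : Set V} {x : V} {K : ℝ}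
    (hA : x ∈ A) (hK : ActivityBounded w ν K x) :
    Real.log (monomerProb w ν A x) ≤ 0 ∧
      -Real.log (1 + K) ≤ Real.log (monomerProb w ν A x) := by
  refine ⟨Real.log_nonpos (monomerProb_pos ..).le (monomerProb_le_one _ _ hA), ?_⟩
  rw [monomerProb_eq w ν hA, Real.log_inv, neg_le_neg_iff]
  have hnn : 0 ≤ ∑ y ∈ neighborsIn G A x, activity w ν y.2 * monomerProb w ν (A \ {x}) y :=
    Finset.sum_nonneg fun _ _ => mul_nonneg (activity_pos ..).le (monomerProb_pos ..).le
  refine Real.log_le_log (by positivity) ?_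
  have : ∑ y ∈ neighborsIn G A x, activity w ν y.2 * monomerProb w ν (A \ {x}) y ≤
      ∑ y ∈ neighborsIn G A x, activity w ν y.2 :=
    Finset.sum_le_sum fun y hy => mul_le_of_le_one_right (activity_pos ..).le
      (monomerProb_le_one _ _ (mem_sdiff_singleton_of_mem_neighborsIn hy))
  linarith [hK A]

open Classical in
variable (G) in
/-- The vertex sequences of walks with `n` steps started at `x`. -/
noncomputable def pathsFrom : ℕ → V → Finset (List V)
  | 0, x => {[x]}
  | n + 1, x => (Finset.univ : Finset (G.neighborSet x)).biUnion
      fun y => (pathsFrom n y).image (List.cons x)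

-- Along each walk, `k` good vertices contribute a factor `K / (1 + K)` each, and one further good
-- vertex supplies the initial bound `log (1 + K)`; this is the `+ 1` in the count. Bad vertices are
-- passed at no cost.
open Classical in
lemma abs_log_monomerProb_sub_le_pow (w : G.edgeSet → ℝ) (ν : V → ℝ) {K : ℝ} (hK0 : 0 ≤ K)
    (n : ℕ) : ∀ (k : ℕ) (x : V) (A B : Set V), x ∈ A → x ∈ B →
      (∀ v, ∀ p : G.Walk x v, p.length ≤ n → (v ∈ A ↔ v ∈ B)) →
      (∀ l ∈ pathsFrom G n x, l.Nodup → (∀ v ∈ l, v ∈ A) →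
        k + 1 ≤ l.countP (fun v => ActivityBounded w ν K v)) →
      |Real.log (monomerProb w ν A x) - Real.log (monomerProb w ν B x)| ≤
        Real.log (1 + K) * (K / (1 + K)) ^ k := by
  have hL : 0 ≤ Real.log (1 + K) := Real.log_nonneg (by linarith)
  have hbase : ∀ (x : V) (A B : Set V), x ∈ A → x ∈ B → ActivityBounded w ν K x →
      |Real.log (monomerProb w ν A x) - Real.log (monomerProb w ν B x)| ≤ Real.log (1 + K) := by
    intro x A B hA hB hg
    have h1 := log_monomerProb_bounds w ν hA hg
    have h2 := log_monomerProb_bounds w ν hB hg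
    rw [abs_le]
    constructor <;> linarith
  induction n with
  | zero =>
    intro k x A B hA hB _ hgood
    have := hgood [x] (by simp [pathsFrom]) (by simp) (by simpa using hA)
    rw [List.countP_singleton] at this
    split_ifs at this with hg
    · obtain rfl : k = 0 := by omega
      simpa using hbase x A B hA hB (by simpa using hg)
    · omega
  | succ n ih =>
    intro k x A B hA hB hAB hgood
    have hnb : neighborsIn G A x = neighborsIn G B x := by
      ext y
      rw [mem_neighborsIn, mem_neighborsIn]
      have hadj : G.Adj x y := y.2
      exact hAB y hadj.toWalk (by simp)
    have hstep : ∀ j, (∀ l ∈ pathsFrom G (n + 1) x, l.Nodup → (∀ v ∈ l, v ∈ A) →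
        j + 1 ≤ l.tail.countP (fun v => ActivityBounded w ν K v)) →
        ∀ y ∈ neighborsIn G A x,
        |Real.log (monomerProb w ν (A \ {x}) y) - Real.log (monomerProb w ν (B \ {x}) y)| ≤
          Real.log (1 + K) * (K / (1 + K)) ^ j := by
      intro j hj y hy
      refine ih j y _ _ (mem_sdiff_singleton_of_mem_neighborsIn hy)
        (mem_sdiff_singleton_of_mem_neighborsIn (hnb ▸ hy)) ?_ ?_
      · intro v p hp
        have hadj : G.Adj x y := y.2
        have := hAB v (SimpleGraph.Walk.cons hadj p) (by simpa using hp)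
        simp only [Set.mem_sdiff, this]
      · intro l hl hnd hlA
        refine hj (x :: l) ?_ ?_ ?_
        · simp only [pathsFrom, Finset.mem_biUnion, Finset.mem_image]
          exact ⟨y, Finset.mem_univ _, l, hl, rfl⟩
        -- The deletion of `x` forces the rest of the walk to avoid it.
        · exact List.nodup_cons.2 ⟨fun hx => (hlA x hx).2 rfl, hnd⟩
        · exact List.forall_mem_cons.2 ⟨hA, fun v hv => (hlA v hv).1⟩
    have hcons : ∀ l ∈ pathsFrom G (n + 1) x, ∃ l', l = x :: l' := by
      intro l hl
      simp only [pathsFrom, Finset.mem_biUnion, Finset.mem_image] at hl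
      obtain ⟨y, _, l', _, rfl⟩ := hl
      exact ⟨l', rfl⟩
    by_cases hg : ActivityBounded w ν K x
    · cases k with
      | zero => simpa using hbase x A B hA hB hg
      | succ k =>
        refine (abs_log_monomerProb_sub_le w ν hA hB hnb (by positivity) (hstep k ?_) hg).trans_eq
          (by ring)
        intro l hl hnd hlA
        have := hgood l hl hnd hlA
        obtain ⟨l', rfl⟩ := hcons l hl
        rw [List.countP_cons_of_pos (by simpa using hg)] at this
        simpa using this
    · refine abs_log_monomerProb_sub_le' w ν hA hB hnb (by positivity) (hstep k ?_)
      intro l hl hnd hlA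
      have := hgood l hl hnd hlA
      obtain ⟨l', rfl⟩ := hcons l hl
      rwa [List.countP_cons_of_neg (by simpa using hg)] at this

lemma card_pathsFrom_le {D : ℕ} (hD : ∀ x : V, Nat.card (G.neighborSet x) ≤ D) (n : ℕ) :
    ∀ x : V, (pathsFrom G n x).card ≤ D ^ n := by
  classical
  induction n with
  | zero => simp [pathsFrom]
  | succ n ih =>
    intro x
    rw [pathsFrom]
    refine (Finset.card_biUnion_le_card_mul (Finset.univ : Finset (G.neighborSet x)) _ (D ^ n) fun y _ =>
      Finset.card_image_le.trans (ih y)).trans ?_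
    rw [pow_succ', Finset.card_univ, ← Nat.card_eq_fintype_card]
    exact Nat.mul_le_mul_right _ (hD x)

lemma length_of_mem_pathsFrom (n : ℕ) :
    ∀ x : V, ∀ l ∈ pathsFrom G n x, l.length = n + 1 := by
  classical
  induction n with
  | zero => simp [pathsFrom]
  | succ n ih =>
    intro x l hl
    simp only [pathsFrom, Finset.mem_biUnion, Finset.mem_image] at hl
    obtain ⟨y, _, l', hl', rfl⟩ := hl
    simp [ih y l' hl']

end Contraction

/-! ### Rarity of walks with few good vertices -/

section Percolation

open scoped ENNReal

lemma exists_nat_measure_lt_abs_le (μ ν : Measure ℝ) [IsFiniteMeasure μ] [IsFiniteMeasure ν]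
    {ε : ℝ≥0∞} (hε : 0 < ε) :
    ∃ T : ℕ, μ {t | (T : ℝ) < |t|} ≤ ε ∧ ν {t | (T : ℝ) < |t|} ≤ ε := by
  have key : ∀ ρ : Measure ℝ, IsFiniteMeasure ρ →
      ∀ᶠ T : ℕ in Filter.atTop, ρ {t | (T : ℝ) < |t|} ≤ ε := by
    intro ρ _
    have h := tendsto_measure_iInter_atTop (μ := ρ) (s := fun n : ℕ => {t : ℝ | (n : ℝ) < |t|})
      (fun n => (measurableSet_lt measurable_const measurable_id.abs).nullMeasurableSet)
      (fun m n hmn t (ht : (n : ℝ) < |t|) => lt_of_le_of_lt (Nat.cast_le.2 hmn) ht) ⟨0, measure_ne_top _ _⟩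
    have hempty : ⋂ n : ℕ, {t : ℝ | (n : ℝ) < |t|} = ∅ := by
      ext t
      simp only [Set.mem_iInter, Set.mem_ofPred_eq, Set.mem_empty_iff_false, iff_false, not_forall,
        not_lt]
      exact exists_nat_ge _
    rw [hempty, measure_empty] at h
    exact (h.eventually (gt_mem_nhds hε)).mono fun _ h => le_of_lt h
  exact ((key μ inferInstance).and (key ν inferInstance)).exists

-- Union bound over the `j`-element sets of indices, each contributing at most `ε ^ j` by
-- independence.
open Classical in
lemma measure_le_card_filter_le {ι Ω : Type*} [MeasurableSpace Ω] {P : Measure Ω}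
    {X : ι → Ω → ℝ} (hX : iIndepFun X P) {T : ℝ} {ε : ℝ≥0∞}
    (hε : ∀ i, P {ω | T < |X i ω|} ≤ ε) (F : Finset ι) (j : ℕ) :
    P {ω | j ≤ (F.filter fun i => T < |X i ω|).card} ≤ 2 ^ F.card * ε ^ j := by
  have hsub : {ω | j ≤ (F.filter fun i => T < |X i ω|).card} ⊆
      ⋃ S ∈ F.powersetCard j, ⋂ i ∈ S, X i ⁻¹' {t | T < |t|} := by
    intro ω hω
    obtain ⟨S, hS, hcard⟩ := Finset.exists_subset_card_eq hω
    simp only [Set.mem_iUnion, Set.mem_iInter, Finset.mem_powersetCard]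
    exact ⟨S, ⟨hS.trans (Finset.filter_subset _ _), hcard⟩,
      fun i hi => (Finset.mem_filter.1 (hS hi)).2⟩
  refine (measure_mono hsub).trans ((measure_biUnion_finset_le _ _).trans ?_)
  calc ∑ S ∈ F.powersetCard j, P (⋂ i ∈ S, X i ⁻¹' {t | T < |t|})
      ≤ ∑ S ∈ F.powersetCard j, ε ^ j := by
        refine Finset.sum_le_sum fun S hS => ?_
        rw [hX.measure_inter_preimage_eq_mul S (sets := fun _ => {t | T < |t|})
          (fun i _ => measurableSet_lt measurable_const measurable_id.abs),
          ← (Finset.mem_powersetCard.1 hS).2]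
        exact Finset.prod_le_pow_card _ _ _ fun i _ => hε i
    _ = (F.card.choose j : ℝ≥0∞) * ε ^ j := by
        rw [Finset.sum_const, Finset.card_powersetCard, nsmul_eq_mul]
    _ ≤ 2 ^ F.card * ε ^ j := by
        gcongr
        exact_mod_cast Nat.choose_le_two_pow _ _

variable {V : Type*} {G : SimpleGraph V} [Fintype V]

open Classical in
variable (G) in
/-- The weights on which the activities at `x` depend. -/
noncomputable def weightsNear (x : V) : Finset (G.edgeSet ⊕ V) :=
  insert (Sum.inr x)
    (Finset.univ.image (fun y : G.neighborSet x => Sum.inr (y : V)) ∪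
      Finset.univ.image (fun y : G.neighborSet x => Sum.inl (⟨s(x, y), y.2⟩ : G.edgeSet)))

lemma inr_mem_weightsNear {x z : V} : Sum.inr z ∈ weightsNear G x ↔ z = x ∨ G.Adj x z := by
  simp [weightsNear]

lemma inl_mem_weightsNear {x : V} {f : G.edgeSet} :
    Sum.inl f ∈ weightsNear G x ↔ x ∈ (f : Sym2 V) := by
  simp only [weightsNear, Finset.mem_insert, Finset.mem_union, Finset.mem_image, Finset.mem_univ,
    true_and, reduceCtorEq, exists_false, false_or, Sum.inl.injEq]
  constructor
  · rintro ⟨y, rfl⟩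
    exact Sym2.mem_mk_left _ _
  · intro hx
    obtain ⟨y, hy⟩ := Sym2.mem_iff_exists.1 hx
    have hadj : G.Adj x y := by
      have := f.2
      rwa [hy] at this
    exact ⟨⟨y, hadj⟩, Subtype.ext hy.symm⟩

lemma card_weightsNear_le {D : ℕ} (hD : ∀ x : V, Nat.card (G.neighborSet x) ≤ D) (x : V) :
    (weightsNear G x).card ≤ 2 * D + 1 := by
  classical
  have hx := hD x
  rw [Nat.card_eq_fintype_card, ← Finset.card_univ] at hx
  refine (Finset.card_insert_le _ _).trans (Nat.succ_le_succ ((Finset.card_union_le _ _).trans ?_))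
  rw [two_mul]
  exact add_le_add (Finset.card_image_le.trans (by convert hx))
    (Finset.card_image_le.trans (by convert hx))

-- An edge weight is near its two endpoints only, a vertex weight near the vertex and its at most
-- `D` neighbours; `D + 2` covers both.
open Classical in
lemma card_filter_mem_weightsNear_le {D : ℕ} (hD : ∀ x : V, Nat.card (G.neighborSet x) ≤ D)
    (i : G.edgeSet ⊕ V) (s : Finset V) :
    (s.filter fun x => i ∈ weightsNear G x).card ≤ D + 2 := by
  rcases i with ⟨f, hf⟩ | z
  · induction f with
    | _ a b =>
      have : s.filter (fun x => Sum.inl ⟨s(a, b), hf⟩ ∈ weightsNear G x) ⊆ {a, b} := by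
        intro x hx
        rw [Finset.mem_filter, inl_mem_weightsNear] at hx
        simpa using hx.2
      exact (Finset.card_le_card this).trans (Finset.card_le_two.trans (by omega))
  · have : s.filter (fun x => Sum.inr z ∈ weightsNear G x) ⊆
        insert z (Finset.univ.image (fun y : G.neighborSet z => (y : V))) := by
      intro x hx
      rw [Finset.mem_filter, inr_mem_weightsNear] at hx
      rw [Finset.mem_insert, Finset.mem_image]
      exact hx.2.imp Eq.symm fun h => ⟨⟨x, h.symm⟩, Finset.mem_univ _, rfl⟩
    have hz := hD z
    rw [Nat.card_eq_fintype_card, ← Finset.card_univ] at hz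
    refine (Finset.card_le_card this).trans ((Finset.card_insert_le _ _).trans ?_)
    have := (Finset.card_image_le (s := (Finset.univ : Finset (G.neighborSet z)))
      (f := fun y : G.neighborSet z => (y : V))).trans hz
    omega

lemma activityBounded_of_abs_le {D : ℕ} (hD : ∀ x : V, Nat.card (G.neighborSet x) ≤ D)
    {w : G.edgeSet → ℝ} {ν : V → ℝ} {T : ℝ} {x : V}
    (h : ∀ i ∈ weightsNear G x, |Sum.elim w ν i| ≤ T) :
    ActivityBounded w ν (D * Real.exp (3 * T)) x := by
  classical
  intro A
  have hx := hD x
  rw [Nat.card_eq_fintype_card, ← Finset.card_univ] at hx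
  have hcard : (neighborsIn G A x).card ≤ D := (Finset.card_le_univ _).trans (by
    rw [← Finset.card_univ]; convert hx)
  calc ∑ y ∈ neighborsIn G A x, activity w ν y.2
      ≤ ∑ y ∈ neighborsIn G A x, Real.exp (3 * T) := by
        refine Finset.sum_le_sum fun y _ => ?_
        unfold activity
        rw [Real.exp_le_exp]
        have hadj : G.Adj x y := y.2
        have h1 := abs_le.1 (h _ (inl_mem_weightsNear.2 (Sym2.mem_mk_left x y) :
          Sum.inl ⟨s(x, y), hadj⟩ ∈ _))
        have h2 := abs_le.1 (h _ (inr_mem_weightsNear.2 (Or.inl rfl)))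
        have h3 := abs_le.1 (h _ (inr_mem_weightsNear.2 (Or.inr hadj)))
        simp only [Sum.elim_inl, Sum.elim_inr] at h1 h2 h3
        linarith [h1.2, h2.1, h3.1]
    _ = (neighborsIn G A x).card * Real.exp (3 * T) := by rw [Finset.sum_const, nsmul_eq_mul]
    _ ≤ D * Real.exp (3 * T) := by gcongr

open Classical in
/-- A path with few vertices of bounded activity has many large weights near it. -/
lemma length_le_mul_card_filter {D : ℕ} (hD : ∀ x : V, Nat.card (G.neighborSet x) ≤ D)
    (w : G.edgeSet → ℝ) (ν : V → ℝ) (T : ℝ) {n : ℕ} {l : List V} (hl : l.length = n + 1)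
    (hnd : l.Nodup)
    (hcount : l.countP (fun v => ActivityBounded w ν (D * Real.exp (3 * T)) v) ≤ n / 2) :
    n + 1 ≤ 2 * (D + 2) *
      ((l.toFinset.biUnion (weightsNear G)).filter fun i => T < |Sum.elim w ν i|).card := by
  set B := l.toFinset.filter fun v => ¬ActivityBounded w ν (D * Real.exp (3 * T)) v with hB
  set F := (l.toFinset.biUnion (weightsNear G)).filter fun i => T < |Sum.elim w ν i| with hF
  have hBcard : B.card = l.countP (fun v => ¬ActivityBounded w ν (D * Real.exp (3 * T)) v) := by
    rw [hB, List.countP_eq_length_filter, ← List.toFinset_card_of_nodup (hnd.filter _),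
      List.toFinset_filter]
    simp only [decide_eq_true_eq]
  have hsum := List.length_eq_countP_add_countP
    (fun v => decide (ActivityBounded w ν (D * Real.exp (3 * T)) v)) (l := l)
  simp only [decide_eq_true_eq] at hsum
  have hex : ∀ v ∈ B, ∃ i ∈ F, i ∈ weightsNear G v := by
    intro v hv
    rw [hB, Finset.mem_filter] at hv
    obtain ⟨hvl, hv⟩ := hv
    by_contra! hcon
    refine hv (activityBounded_of_abs_le hD fun i hi => ?_)
    by_contra! hlt
    exact hcon i (Finset.mem_filter.2 ⟨Finset.mem_biUnion.2 ⟨v, hvl, hi⟩, hlt⟩) hi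
  -- Each bad vertex has a large weight near it, and a large weight serves at most `D + 2` bad
  -- vertices.
  have hBF : B.card ≤ (D + 2) * F.card := by
    have hsub : B ⊆ F.biUnion fun i => B.filter fun v => i ∈ weightsNear G v := by
      intro v hv
      obtain ⟨i, hi, hiv⟩ := hex v hv
      exact Finset.mem_biUnion.2 ⟨i, hi, Finset.mem_filter.2 ⟨hv, hiv⟩⟩
    refine (Finset.card_le_card hsub).trans ((Finset.card_biUnion_le_card_mul _ _ (D + 2)
      fun i _ => card_filter_mem_weightsNear_le hD i B).trans_eq (mul_comm _ _))
  have : n + 1 ≤ 2 * B.card := by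
    rw [hBcard]
    omega
  calc n + 1 ≤ 2 * B.card := this
    _ ≤ 2 * ((D + 2) * F.card) := by gcongr
    _ = _ := by ring

open Classical in
/-- Some self-avoiding walk with `n` steps from `x` has at most `n / 2` vertices whose total
activity is at most `K`. -/
def HasBadPath (w : G.edgeSet → ℝ) (ν : V → ℝ) (K : ℝ) (n : ℕ) (x : V) : Prop :=
  ∃ l ∈ pathsFrom G n x, l.Nodup ∧ l.countP (fun v => ActivityBounded w ν K v) ≤ n / 2

/-- With `m = n + 1` vertices there are at most `(D + 1) ^ m` walks and `2 ^ ((2 * D + 1) * m)` sets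
of nearby weights, together `a ^ m`. A bad walk needs at least `m / (2 * (D + 2))` large weights, so
the exponent `2 * (D + 2)` in the tail bound yields `(a⁻¹ * 2⁻¹) ^ m`, which beats this count and
leaves `2⁻¹ ^ m`. -/
lemma measure_hasBadPath_le {D : ℕ} (hD : ∀ x : V, Nat.card (G.neighborSet x) ≤ D)
    {Ω : Type*} [MeasurableSpace Ω] {P : Measure Ω} {w : G.edgeSet → Ω → ℝ} {ν : V → Ω → ℝ}
    (hind : iIndepFun (Sum.elim w ν) P) {T : ℝ}
    (hT : ∀ i, P {ω | T < |Sum.elim w ν i ω|} ≤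
      ((((D + 1 : ℕ) : ℝ≥0∞) * 2 ^ (2 * D + 1))⁻¹ * 2⁻¹) ^ (2 * (D + 2))) (n : ℕ) (x : V) :
    P {ω | HasBadPath (fun f => w f ω) (fun x => ν x ω) (D * Real.exp (3 * T)) n x} ≤
      2⁻¹ ^ (n + 1) := by
  classical
  set a : ℝ≥0∞ := ((D + 1 : ℕ) : ℝ≥0∞) * 2 ^ (2 * D + 1) with ha
  have ha0 : a ≠ 0 := by simp [ha]
  have hatop : a ≠ ∞ := ENNReal.mul_ne_top (by simp) (by simp)
  set j := (n + 1) ⌈/⌉ (2 * (D + 2)) with hj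
  have hjle : n + 1 ≤ 2 * (D + 2) * j := by
    have := le_smul_ceilDiv (a := 2 * (D + 2)) (b := n + 1) (by omega)
    simpa using this
  have hη : a⁻¹ * 2⁻¹ ≤ 1 := by
    refine mul_le_one' (ENNReal.inv_le_one.2 ?_) (ENNReal.inv_le_one.2 one_le_two)
    exact one_le_mul (by simp) (one_le_pow₀ one_le_two)
  have hsub : {ω | HasBadPath (fun f => w f ω) (fun x => ν x ω) (D * Real.exp (3 * T)) n x} ⊆
      ⋃ l ∈ pathsFrom G n x, {ω | j ≤ ((l.toFinset.biUnion (weightsNear G)).filter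
        fun i => T < |Sum.elim w ν i ω|).card} := by
    rintro ω ⟨l, hl, hnd, hcount⟩
    simp only [Set.mem_iUnion]
    refine ⟨l, hl, ?_⟩
    have := length_le_mul_card_filter hD _ _ T (length_of_mem_pathsFrom n x l hl) hnd hcount
    have helim : ∀ i, Sum.elim (fun f => w f ω) (fun x => ν x ω) i = Sum.elim w ν i ω := by
      rintro (i | i) <;> rfl
    simp only [helim] at this
    rw [Set.mem_ofPred_eq, hj, ceilDiv_le_iff_le_smul (by omega), smul_eq_mul]
    exact this
  have hcardF : ∀ l ∈ pathsFrom G n x,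
      (l.toFinset.biUnion (weightsNear G)).card ≤ (2 * D + 1) * (n + 1) := by
    intro l hl
    refine (Finset.card_biUnion_le_card_mul _ _ (2 * D + 1)
      fun v _ => card_weightsNear_le hD v).trans ?_
    rw [mul_comm, ← length_of_mem_pathsFrom n x l hl]
    exact Nat.mul_le_mul_left _ (List.toFinset_card_le l)
  refine (measure_mono hsub).trans ((measure_biUnion_finset_le _ _).trans ?_)
  calc ∑ l ∈ pathsFrom G n x, P {ω | j ≤ ((l.toFinset.biUnion (weightsNear G)).filter
          fun i => T < |Sum.elim w ν i ω|).card}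
      ≤ ∑ l ∈ pathsFrom G n x, 2 ^ ((2 * D + 1) * (n + 1)) * (a⁻¹ * 2⁻¹) ^ (n + 1) := by
        refine Finset.sum_le_sum fun l hl =>
          (measure_le_card_filter_le hind hT _ j).trans ?_
        gcongr ?_ * ?_
        · exact pow_le_pow_right₀ one_le_two (hcardF l hl)
        · rw [← pow_mul]
          exact pow_le_pow_right_of_le_one' hη hjle
    _ = (pathsFrom G n x).card * (2 ^ ((2 * D + 1) * (n + 1)) * (a⁻¹ * 2⁻¹) ^ (n + 1)) := by
        rw [Finset.sum_const, nsmul_eq_mul]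
    _ ≤ ((D + 1 : ℕ) : ℝ≥0∞) ^ (n + 1) *
          (2 ^ ((2 * D + 1) * (n + 1)) * (a⁻¹ * 2⁻¹) ^ (n + 1)) := by
        gcongr
        have := card_pathsFrom_le hD n x
        have h2 : (pathsFrom G n x).card ≤ (D + 1) ^ (n + 1) :=
          this.trans ((Nat.pow_le_pow_left (Nat.le_succ D) n).trans
            (Nat.pow_le_pow_right (Nat.succ_pos D) (Nat.le_succ n)))
        exact_mod_cast h2
    _ = (a * (a⁻¹ * 2⁻¹)) ^ (n + 1) := by
        rw [pow_mul, ← mul_assoc, ← mul_pow, ← mul_pow]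
    _ = 2⁻¹ ^ (n + 1) := by
        rw [← mul_assoc, ENNReal.mul_inv_cancel ha0 hatop, one_mul]

end Percolation

/-! ### From monomer probabilities to edge marginals and expectations -/

section Decay

/-- The logarithm has slope at least `1` on `(0, 1]`. -/
lemma abs_sub_le_abs_log_sub_log {a b : ℝ} (ha : 0 < a) (ha1 : a ≤ 1) (hb : 0 < b) (hb1 : b ≤ 1) :
    |a - b| ≤ |Real.log a - Real.log b| := by
  wlog hab : b ≤ a generalizing a b
  · rw [abs_sub_comm, abs_sub_comm (Real.log a)]
    exact this hb hb1 ha ha1 (le_of_not_ge hab)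
  rw [abs_of_nonneg (sub_nonneg.2 hab), abs_of_nonneg (sub_nonneg.2 (Real.log_le_log hb hab))]
  have h := Real.log_le_sub_one_of_pos (div_pos hb ha)
  rw [Real.log_div hb.ne' ha.ne'] at h
  have h2 : a - b ≤ 1 - b / a := by
    rw [one_sub_div ha.ne', le_div_iff₀ ha]
    nlinarith
  linarith

variable {V : Type*} {G : SimpleGraph V} [Fintype V]

omit [Fintype V] in
lemma top_eq_induce_univ : (⊤ : G.Subgraph) = (⊤ : G.Subgraph).induce Set.univ := by
  simpa using (SimpleGraph.Subgraph.induce_self_verts (G' := (⊤ : G.Subgraph))).symm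

lemma abs_log_monomerProb_sub_le_of_not_hasBadPath (w : G.edgeSet → ℝ) (ν : V → ℝ) {K : ℝ}
    (hK : 0 ≤ K) {n : ℕ} {x : V} {A B : Set V} (hA : x ∈ A) (hB : x ∈ B)
    (hAB : ∀ v, ∀ p : G.Walk x v, p.length ≤ n → (v ∈ A ↔ v ∈ B))
    (hbad : ¬HasBadPath w ν K n x) :
    |Real.log (monomerProb w ν A x) - Real.log (monomerProb w ν B x)| ≤
      Real.log (1 + K) * (K / (1 + K)) ^ (n / 2) := by
  refine abs_log_monomerProb_sub_le_pow w ν hK n _ x A B hA hB hAB fun l hl hnd _ => ?_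
  unfold HasBadPath at hbad
  push Not at hbad
  exact hbad l hl hnd

/-- Comparing logarithms of the two marginals cancels the activity of the edge, which may be
arbitrarily large. The two remaining monomer factors account for the `2`. -/
lemma abs_edgeMarginal_sub_le (w : G.edgeSet → ℝ) (ν : V → ℝ) {K : ℝ} (hK : 0 ≤ K)
    {x y : V} (h : G.Adj x y) {R : ℝ} (hR : 0 ≤ R)
    (hx : ¬HasBadPath w ν K ⌊R⌋₊ x) (hy : ¬HasBadPath w ν K ⌊R⌋₊ y) :
    |edgeMarginal (⊤ : G.Subgraph) w ν ⟨s(x, y), h⟩ -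
        edgeMarginal (edgeBall G s(x, y) R) w ν ⟨s(x, y), h⟩| ≤
      2 * Real.log (1 + K) * (K / (1 + K)) ^ (⌊R⌋₊ / 2) := by
  set B : Set V := {v | ∃ z ∈ s(x, y), G.Reachable z v ∧ (G.dist z v : ℝ) ≤ R} with hB
  have hball : ∀ z ∈ s(x, y), ∀ v, ∀ p : G.Walk z v, p.length ≤ ⌊R⌋₊ → v ∈ B := by
    intro z hz v p hp
    refine ⟨z, hz, p.reachable, le_trans ?_ (Nat.floor_le hR)⟩
    exact_mod_cast (SimpleGraph.dist_le p).trans hp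
  have hxB : x ∈ B := hball x (Sym2.mem_mk_left _ _) x SimpleGraph.Walk.nil (Nat.zero_le _)
  have hyB : y ∈ B := hball y (Sym2.mem_mk_right _ _) y SimpleGraph.Walk.nil (Nat.zero_le _)
  have hyx : y ∉ ({x} : Set V) := fun hyx => G.ne_of_adj h (Set.mem_singleton_iff.1 hyx).symm
  have h1 := abs_log_monomerProb_sub_le_of_not_hasBadPath w ν hK (Set.mem_univ x) hxB
    (fun v p hp => by simp [hball x (Sym2.mem_mk_left _ _) v p hp]) hx
  have h2 := abs_log_monomerProb_sub_le_of_not_hasBadPath w ν hK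
    (A := Set.univ \ {x}) (B := B \ {x}) ⟨Set.mem_univ y, hyx⟩ ⟨hyB, hyx⟩
    (fun v p hp => by simp [hball y (Sym2.mem_mk_right _ _) v p hp]) hy
  have hm1 := edgeMarginal_induce w ν (Set.mem_univ x) (Set.mem_univ y) h
  have hm2 := edgeMarginal_induce w ν hxB hyB h
  rw [← top_eq_induce_univ] at hm1
  change edgeMarginal (edgeBall G s(x, y) R) w ν _ = _ at hm2
  have ha := activity_pos w ν h
  have p1 := monomerProb_pos w ν Set.univ x
  have p2 := monomerProb_pos w ν (Set.univ \ {x}) y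
  have p3 := monomerProb_pos w ν B x
  have p4 := monomerProb_pos w ν (B \ {x}) y
  refine (abs_sub_le_abs_log_sub_log (hm1 ▸ by positivity) (edgeMarginal_le_one ..)
    (hm2 ▸ by positivity) (edgeMarginal_le_one ..)).trans ?_
  rw [hm1, hm2, Real.log_mul ha.ne' (by positivity), Real.log_mul p1.ne' p2.ne',
    Real.log_mul ha.ne' (by positivity), Real.log_mul p3.ne' p4.ne']
  rw [abs_le] at h1 h2 ⊢
  constructor <;> linarith [h1.1, h1.2, h2.1, h2.2]

lemma measurable_edgeMarginal (H : G.Subgraph) (e : G.edgeSet) :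
    Measurable fun p : (G.edgeSet → ℝ) × (V → ℝ) => edgeMarginal H p.1 p.2 e := by
  unfold edgeMarginal gibbsExpectation gibbs partitionFunction boltzmann
  fun_prop

lemma aemeasurable_edgeMarginal {Ω : Type*} [MeasurableSpace Ω] {P : Measure Ω}
    {w : G.edgeSet → Ω → ℝ} {ν : V → Ω → ℝ} (hw : ∀ f, AEMeasurable (w f) P)
    (hν : ∀ x, AEMeasurable (ν x) P) (H : G.Subgraph) (e : G.edgeSet) :
    AEMeasurable (fun ω => edgeMarginal H (fun f => w f ω) (fun x => ν x ω) e) P := by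
  have : Countable G.edgeSet := Finite.to_countable
  have hw' : AEMeasurable (fun ω f => w f ω) P := aemeasurable_pi_lambda _ hw
  have hν' : AEMeasurable (fun ω x => ν x ω) P := aemeasurable_pi_lambda _ hν
  have h := (measurable_edgeMarginal H e).comp_aemeasurable (hw'.prodMk hν')
  exact h

lemma abs_edgeMarginal_sub_le_one (H H' : G.Subgraph) (w : G.edgeSet → ℝ) (ν : V → ℝ)
    (e : G.edgeSet) : |edgeMarginal H w ν e - edgeMarginal H' w ν e| ≤ 1 := by
  rw [abs_le]
  constructor <;> linarith [edgeMarginal_nonneg H w ν e, edgeMarginal_le_one H w ν e,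
    edgeMarginal_nonneg H' w ν e, edgeMarginal_le_one H' w ν e]

/-- `S` may be non-measurable, so the integral is split along its measurable hull. -/
lemma integral_le_measureReal_add {Ω : Type*} [MeasurableSpace Ω] {P : Measure Ω}
    [IsProbabilityMeasure P] {f : Ω → ℝ} (hf : Integrable f P) (hf1 : ∀ ω, f ω ≤ 1) {S : Set Ω}
    {b : ℝ} (hb : 0 ≤ b) (hS : ∀ ω ∉ S, f ω ≤ b) : ∫ ω, f ω ∂P ≤ P.real S + b := by
  have hm := measurableSet_toMeasurable P S
  calc ∫ ω, f ω ∂P ≤ ∫ ω, ((toMeasurable P S).indicator (fun _ => (1 : ℝ)) ω + b) ∂P := by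
        refine integral_mono hf (((integrable_const (1 : ℝ)).indicator hm).add
          (integrable_const b)) fun ω => ?_
        by_cases hω : ω ∈ toMeasurable P S
        · simp only [Set.indicator_of_mem hω]
          linarith [hf1 ω]
        · simp only [Set.indicator_of_notMem hω, zero_add]
          exact hS ω fun h => hω (subset_toMeasurable P S h)
    _ = P.real S + b := by
        rw [integral_add ((integrable_const (1 : ℝ)).indicator hm) (integrable_const b),
          integral_indicator_const _ hm, measureReal_def, measure_toMeasurable]
        simp [measureReal_def]

lemma pow_half_floor_le {κ R : ℝ} (h0 : 0 < κ) (h1 : κ < 1) :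
    κ ^ (⌊R⌋₊ / 2) ≤ κ⁻¹ * Real.exp (-(-Real.log κ / 2) * R) := by
  have hlog : Real.log κ < 0 := Real.log_neg h0 h1
  -- The two roundings lower the exponent by at most `1` below `R / 2`, which costs the factor
  -- `κ⁻¹`.
  have hn : R / 2 - 1 ≤ ((⌊R⌋₊ / 2 : ℕ) : ℝ) := by
    have h2 : ⌊R⌋₊ ≤ 2 * (⌊R⌋₊ / 2) + 1 := by omega
    have h3 : (⌊R⌋₊ : ℝ) ≤ 2 * ((⌊R⌋₊ / 2 : ℕ) : ℝ) + 1 := by exact_mod_cast h2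
    linarith [Nat.lt_floor_add_one R]
  have hinv : κ⁻¹ = Real.exp (-Real.log κ) := by rw [Real.exp_neg, Real.exp_log h0]
  rw [← Real.exp_log (pow_pos h0 (⌊R⌋₊ / 2)), Real.log_pow, hinv, ← Real.exp_add, Real.exp_le_exp]
  nlinarith

end Decay

end MonomerDimer

/-! ### The main theorem -/

open MonomerDimer in
theorem mainTheorem4 (D : ℕ) (μw μν : Measure ℝ)
    [IsProbabilityMeasure μw] [IsProbabilityMeasure μν] :
    ∃ c > (0 : ℝ), ∃ C > (0 : ℝ),
      ∀ (V : Type u) [Fintype V] (G : SimpleGraph V) [DecidableRel G.Adj],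
        G.maxDegree ≤ D →
      ∀ (Ω : Type v) [MeasurableSpace Ω] (P : Measure Ω) [IsProbabilityMeasure P]
        (w : G.edgeSet → Ω → ℝ) (ν : V → Ω → ℝ),
        (∀ f, HasLaw (w f) μw P) → (∀ x, HasLaw (ν x) μν P) →
        iIndepFun (Sum.elim w ν) P →
      ∀ (e : G.edgeSet) (R : ℝ), 1 ≤ R →
        Integrable (fun ω =>
          |MonomerDimer.edgeMarginal (⊤ : G.Subgraph) (fun f => w f ω) (fun x => ν x ω) e
            - MonomerDimer.edgeMarginal (MonomerDimer.edgeBall G e R)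
                (fun f => w f ω) (fun x => ν x ω) e|) P ∧
        ∫ ω, |MonomerDimer.edgeMarginal (⊤ : G.Subgraph) (fun f => w f ω) (fun x => ν x ω) e
            - MonomerDimer.edgeMarginal (MonomerDimer.edgeBall G e R)
                (fun f => w f ω) (fun x => ν x ω) e| ∂P
          ≤ C * Real.exp (-c * R) := by
  obtain ⟨T, hTw, hTν⟩ := exists_nat_measure_lt_abs_le μw μν
    (ε := ((((D + 1 : ℕ) : ENNReal) * 2 ^ (2 * D + 1))⁻¹ * 2⁻¹) ^ (2 * (D + 2)))
    (ENNReal.pow_pos (ENNReal.mul_pos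
      (ENNReal.inv_ne_zero.2 (ENNReal.mul_ne_top (by simp) (by simp))) (by simp)) _)
  set K : ℝ := D * Real.exp (3 * T) with hKdef
  have hK : 0 ≤ K := by positivity
  have hL : 0 ≤ Real.log (1 + K) := Real.log_nonneg (by linarith)
  -- The floor `2⁻¹` keeps `κ` positive when `D = 0`, where `K = 0`, and lets `κ` also dominate the
  -- rate of the bad event.
  set κ : ℝ := max (K / (1 + K)) 2⁻¹ with hκ
  have hκ2 : 2⁻¹ ≤ κ := le_max_right _ _
  have hκ0 : 0 < κ := lt_of_lt_of_le (by norm_num) hκ2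
  have hκ1 : κ < 1 := max_lt ((div_lt_one (by linarith)).2 (by linarith)) (by norm_num)
  refine ⟨-Real.log κ / 2, by linarith [Real.log_neg hκ0 hκ1],
    (1 + 2 * Real.log (1 + K)) * κ⁻¹, by positivity, ?_⟩
  intro V _ G _ hdeg Ω _ P _ w ν hw hν hind e R hR
  have hD : ∀ x : V, Nat.card (G.neighborSet x) ≤ D := fun x => by
    rw [Nat.card_eq_fintype_card, SimpleGraph.card_neighborSet_eq_degree]
    exact (G.degree_le_maxDegree x).trans hdeg
  have hint : Integrable (fun ω =>
      |edgeMarginal (⊤ : G.Subgraph) (fun f => w f ω) (fun x => ν x ω) e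
        - edgeMarginal (edgeBall G e R) (fun f => w f ω) (fun x => ν x ω) e|) P := by
    have hmeas := fun H => (aemeasurable_edgeMarginal (fun f => (hw f).aemeasurable)
      (fun x => (hν x).aemeasurable) H e).aestronglyMeasurable
    refine Integrable.of_bound ((hmeas ⊤).sub (hmeas (edgeBall G e R))).norm 1
      (Filter.Eventually.of_forall fun ω => ?_)
    rw [Real.norm_eq_abs, abs_abs]
    exact abs_edgeMarginal_sub_le_one ..
  refine ⟨hint, ?_⟩
  obtain ⟨e, he⟩ := e
  induction e with
  | _ x y =>
    have hadj : G.Adj x y := he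
    set n := ⌊R⌋₊ with hn
    have hms : MeasurableSet {t : ℝ | (T : ℝ) < |t|} :=
      measurableSet_lt measurable_const measurable_id.abs
    have hT : ∀ i, P {ω | (T : ℝ) < |Sum.elim w ν i ω|} ≤
        ((((D + 1 : ℕ) : ENNReal) * 2 ^ (2 * D + 1))⁻¹ * 2⁻¹) ^ (2 * (D + 2)) := by
      rintro (f | z)
      · exact ((hw f).measure_eq hms).trans_le hTw
      · exact ((hν z).measure_eq hms).trans_le hTν
    have hbad := fun z => measure_hasBadPath_le hD hind hT n z
    set S : V → Set Ω :=
      fun z => {ω | HasBadPath (fun f => w f ω) (fun x => ν x ω) K n z} with hS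
    have hreal : ∀ z, P.real (S z) ≤ 2⁻¹ ^ (n + 1) := fun z => by
      have := ENNReal.toReal_mono (by simp) (hbad z)
      simpa [measureReal_def] using this
    have hmain := integral_le_measureReal_add hint (fun ω => abs_edgeMarginal_sub_le_one ..)
      (S := S x ∪ S y) (b := 2 * Real.log (1 + K) * (K / (1 + K)) ^ (n / 2)) (by positivity)
      fun ω hω => abs_edgeMarginal_sub_le _ _ hK hadj (by linarith)
        (fun h => hω (Or.inl h)) (fun h => hω (Or.inr h))
    refine hmain.trans ?_
    -- The bad events at the two endpoints have total probability at most `2 * 2⁻¹ ^ (n + 1) = 2⁻¹ ^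
    -- n`.
    have h1 : P.real (S x ∪ S y) ≤ κ ^ (n / 2) := by
      calc P.real (S x ∪ S y) ≤ P.real (S x) + P.real (S y) := measureReal_union_le _ _
        _ ≤ 2⁻¹ ^ (n + 1) + 2⁻¹ ^ (n + 1) := add_le_add (hreal x) (hreal y)
        _ = 2⁻¹ ^ n := by ring
        _ ≤ κ ^ n := by gcongr
        _ ≤ κ ^ (n / 2) := pow_le_pow_of_le_one hκ0.le hκ1.le (Nat.div_le_self n 2)
    have h2 : (K / (1 + K)) ^ (n / 2) ≤ κ ^ (n / 2) := by
      gcongr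
      exact le_max_left _ _
    calc P.real (S x ∪ S y) + 2 * Real.log (1 + K) * (K / (1 + K)) ^ (n / 2)
        ≤ κ ^ (n / 2) + 2 * Real.log (1 + K) * κ ^ (n / 2) := by gcongr
      _ = (1 + 2 * Real.log (1 + K)) * κ ^ (n / 2) := by ring
      _ ≤ (1 + 2 * Real.log (1 + K)) * (κ⁻¹ * Real.exp (-(-Real.log κ / 2) * R)) := by
          gcongr
          exact pow_half_floor_le hκ0 hκ1
      _ = _ := by ring
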